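/- **Setting.** Let $(X_i,Y_i)_{i\ge1}$ be i.i.d. random pairs on a probability space $(\Omega,\mathcal F,\mathbb P)$, distributed as $(X,Y)$, with $X\in\mathbb R^d$ and $Y\in\mathbb R$. Consider one of the following regression problems, with mean function $h=h(x;\beta_0,\beta)$ and loss $\ell(x,y;\beta_0,\beta)$, where $\beta_0\in\mathbb R$, $\beta\in\mathbb R^d$: * Linear: $h=\beta_0+\beta^\top x$, $\ell=(y-h)^2$. * Logistic ($Y\in\{0,1\}$ a.s.): $h=(1+e^{-(\beta_0+\beta^\top x)})^{-1}$, $\ell=-\{y\log h+(1-y)\log(1-h)\}$. * Poisson ($Y\in\{0,1,2,\dots\}$ a.s.): $h=e^{\beta_0+\beta^\top x}$, $\ell=-\{y\log h-h-\log(y!)\}$. * Gamma with fixed shape $\nu>0$ ($Y>0$ a.s.): $h=e^{\beta_0+\beta^\top x}$, $\ell=-\{-\nu\log h+(\nu-1)\log y-y\nu/h\}$. Let $m\ge1$, let $C_1,\dots,C_m\ge0$, let $U\subset\mathbb R$ be compact and non-empty, and let $\mathbb T_k=\{(\beta_0,\beta)\in U\times\mathbb R^d:\ g(\beta)\le C_k\}$,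 where $g$ is one of $g(\beta)=\|\beta\|_1$ (Lasso), $g(\beta)=\|\beta\|_2$ (Ridge), $g(\beta)=\alpha\|\beta\|_1+(1-\alpha)\|\beta\|_2^2$ with $\alpha\in(0,1)$ (Elastic-net). Put $$r(\beta_0,\beta)=\mathbb E\,\ell(X,Y;\beta_0,\beta),\qquad R_n(\beta_0,\beta)=\frac1n\sum_{i=1}^n\ell(X_i,Y_i;\beta_0,\beta).$$ Let $P_{k,n}$ ($k\in\{1,\dots,m\}$, $n\ge1$) be random variables, possibly depending on the data, with $P_{k,n}>0$ a.s., $P_{k,n}\to0$ in probability as $n\to\infty$ for every $k$, and $\sqrt n\,(P_{l,n}-P_{k,n})\to\infty$ in probability as $n\to\infty$ whenever $k<l$. Define $$k^*=\min\operatorname*{arg\,min}_{k\in\{1,\dots,m\}}\Big\{\min_{\mathbb T_k}r\Big\},\qquad \hat K_n=\min\operatorname*{arg\,min}_{k\in\{1,\dots,m\}}\Big\{\min_{\mathbb T_k}R_n+P_{k,n}\Big\}.$$ **Proposition.** Assume, in the corresponding regression problem: 1. Linear: $X$ and $Y$ have finite fourth moments. 2. Logistic: $X$ has a finite second moment. 3.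 Poisson and Gamma: $X$ is Gaussian or sub-Gaussian, and $Y$ has a finite fourth moment; in the Gamma problem with $\nu\ne1$, also $\mathbb E|\log Y|<\infty$. (Here $X$ is sub-Gaussian if for some $c\ge0$, $\mathbb E\,e^{t\,u^\top(X-\mathbb EX)}\le e^{c\|u\|_2^2t^2/2}$ for all $u\in\mathbb R^d$, $t\in\mathbb R$.) Then $r$ is finite on each $\mathbb T_k$, all the minima above are attained, and the PanIC estimator is consistent: $\hat K_n\to k^*$ in probability as $n\to\infty$. -/

import Mathlib

open MeasureTheory ProbabilityTheory Filter Topology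

namespace PanIC

/-! ### Generic risk minimisation and model selection -/

section Generic

/-- Empirical risk `(1/n) ∑ ℓ(Z_i; θ)` over the first `n` observations `Z 0, …, Z (n - 1)`. -/
noncomputable def empiricalRisk {Ω 𝒵 Θ : Type*} (ℓ : 𝒵 → Θ → ℝ) (Z : ℕ → Ω → 𝒵)
    (n : ℕ) (ω : Ω) (θ : Θ) : ℝ :=
  (1 / (n : ℝ)) * ∑ i ∈ Finset.range n, ℓ (Z i ω) θ

/-- Expected risk `E ℓ(Z; θ)`. -/
noncomputable def expectedRisk {Ω 𝒵 Θ : Type*} [MeasurableSpace Ω] (P : Measure Ω)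
    (ℓ : 𝒵 → Θ → ℝ) (Z : Ω → 𝒵) (θ : Θ) : ℝ :=
  ∫ ω, ℓ (Z ω) θ ∂P

/-- The value `min_{θ ∈ T} f θ` (the infimum, which is the minimum whenever it is attained). -/
noncomputable def minValue {Θ : Type*} (T : Set Θ) (f : Θ → ℝ) : ℝ := sInf (f '' T)

open Classical in
/-- The set of minimisers of `v : Fin m → ℝ`. -/
noncomputable def argmin {m : ℕ} (v : Fin m → ℝ) : Finset (Fin m) :=
  {k | ∀ j, v k ≤ v j}

theorem argmin_nonempty {m : ℕ} [NeZero m] (v : Fin m → ℝ) : (argmin v).Nonempty := by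
  obtain ⟨k, -, hk⟩ := Finset.exists_min_image Finset.univ v Finset.univ_nonempty
  exact ⟨k, by simpa [argmin] using hk⟩

/-- `min argmin_k v k`, the smallest index at which `v` is minimal. -/
noncomputable def minArgmin {m : ℕ} [NeZero m] (v : Fin m → ℝ) : Fin m :=
  (argmin v).min' (argmin_nonempty v)

/-- The optimal hypothesis index `k* = min argmin_k min_{θ ∈ T_k} r(θ)`. -/
noncomputable def optimalIndex {Ω 𝒵 Θ : Type*} [MeasurableSpace Ω] {m : ℕ} [NeZero m]
    (P : Measure Ω) (ℓ : 𝒵 → Θ → ℝ) (T : Fin m → Set Θ) (Z : Ω → 𝒵) : Fin m :=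
  minArgmin fun k => minValue (T k) (expectedRisk P ℓ Z)

/-- The PanIC estimator `K̂_n = min argmin_k {min_{θ ∈ T_k} R_n(θ) + P_{k,n}}`. -/
noncomputable def panicIndex {Ω 𝒵 Θ : Type*} {m : ℕ} [NeZero m]
    (ℓ : 𝒵 → Θ → ℝ) (T : Fin m → Set Θ) (Z : ℕ → Ω → 𝒵) (pen : Fin m → ℕ → Ω → ℝ)
    (n : ℕ) (ω : Ω) : Fin m :=
  minArgmin fun k => minValue (T k) (empiricalRisk ℓ Z n ω) + pen k n ω

/-- The PanIC penalties: positive random variables with `P_{k,n} = o_P(1)` for every `k`, and with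
`√n (P_{l,n} - P_{k,n}) → ∞` in probability for `k < l`. -/
structure IsPenalty {Ω : Type*} [MeasurableSpace Ω] (P : Measure Ω) {m : ℕ}
    (pen : Fin m → ℕ → Ω → ℝ) : Prop where
  aemeasurable : ∀ k n, AEMeasurable (pen k n) P
  pos : ∀ k n, 1 ≤ n → ∀ᵐ ω ∂P, 0 < pen k n ω
  vanishing : ∀ k, TendstoInMeasure P (pen k) atTop (fun _ => 0)
  gap : ∀ k l, k < l → ∀ M : ℝ,
    Tendsto (fun n : ℕ => P {ω | Real.sqrt n * (pen l n ω - pen k n ω) ≤ M}) atTop (𝓝 0)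

/-- A random vector is sub-Gaussian if, for some constant `c`, every centred linear marginal
`⟪u, X - E X⟫` has moment generating function at most `exp (c ‖u‖² t² / 2)`. -/
def IsSubGaussian {Ω : Type*} [MeasurableSpace Ω] {d : ℕ} (P : Measure Ω)
    (X : Ω → EuclideanSpace ℝ (Fin d)) : Prop :=
  ∃ c : NNReal, ∀ u : EuclideanSpace ℝ (Fin d),
    HasSubgaussianMGF (fun ω => inner ℝ u (X ω - ∫ ω', X ω' ∂P)) (c * ‖u‖₊ ^ 2) P

end Generic

/-! ### The four generalized linear models -/

/-- The regression problems; `gamma ν` has the (fixed) shape parameter `ν > 0`. -/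
inductive GLM where
  | linear : GLM
  | logistic : GLM
  | poisson : GLM
  | gamma (ν : ℝ) (hν : 0 < ν) : GLM

namespace GLM

/-- The response space of each regression problem. -/
def responses : GLM → Set ℝ
  | linear => Set.univ
  | logistic => {0, 1}
  | poisson => Set.range (fun n : ℕ => (n : ℝ))
  | gamma _ _ => Set.Ioi 0

/-- The mean function, as a function of the linear predictor `η = β₀ + βᵀ x`. -/
noncomputable def mean : GLM → ℝ → ℝ
  | linear, η => η
  | logistic, η => (1 + Real.exp (-η))⁻¹
  | poisson, η => Real.exp η
  | gamma _ _, η => Real.exp η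

/-- The loss as a function of the mean `h` and the response `y`. For Poisson regression `y` is a
natural number, so that `⌊y⌋₊ = y`. -/
noncomputable def lossOfMean : GLM → ℝ → ℝ → ℝ
  | linear, h, y => (y - h) ^ 2
  | logistic, h, y => -(y * Real.log h + (1 - y) * Real.log (1 - h))
  | poisson, h, y => -(y * Real.log h - h - Real.log (Nat.factorial ⌊y⌋₊))
  | gamma ν _, h, y => -(-ν * Real.log h + (ν - 1) * Real.log y - y * ν / h)

/-- The loss `ℓ(x, y; β₀, β)`. -/
noncomputable def loss {d : ℕ} (G : GLM) (z : EuclideanSpace ℝ (Fin d) × ℝ)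
    (θ : ℝ × EuclideanSpace ℝ (Fin d)) : ℝ :=
  G.lossOfMean (G.mean (θ.1 + inner ℝ θ.2 z.1)) z.2

/-- The distributional condition on `(X, Y)` for each regression problem. For Gamma regression
with `ν ≠ 1`, the term `(ν - 1) log Y` of the loss is required to have an expectation. -/
def Condition {Ω : Type*} [MeasurableSpace Ω] {d : ℕ} (P : Measure Ω)
    (X : Ω → EuclideanSpace ℝ (Fin d)) (Y : Ω → ℝ) : GLM → Prop
  | linear => MemLp X 4 P ∧ MemLp Y 4 P
  | logistic => MemLp X 2 P
  | poisson => (HasGaussianLaw X P ∨ IsSubGaussian P X) ∧ MemLp Y 4 P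
  | gamma ν _ => (HasGaussianLaw X P ∨ IsSubGaussian P X) ∧ MemLp Y 4 P ∧
      (ν ≠ 1 → Integrable (fun ω => Real.log (Y ω)) P)

end GLM

/-! ### Regularized parameter spaces -/

/-- The three types of constraints. -/
inductive Constraint where
  | lasso : Constraint
  | ridge : Constraint
  | elasticNet (α : ℝ) (hα : α ∈ Set.Ioo (0 : ℝ) 1) : Constraint

namespace Constraint

/-- `‖β‖₁`, `‖β‖₂` or `α ‖β‖₁ + (1 - α) ‖β‖₂²`. -/
noncomputable def size {d : ℕ} : Constraint → EuclideanSpace ℝ (Fin d) → ℝ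
  | lasso, β => ∑ j, |β j|
  | ridge, β => ‖β‖
  | elasticNet α _, β => α * ∑ j, |β j| + (1 - α) * ‖β‖ ^ 2

/-- The parameter space of pairs `(β₀, β)` with `β₀ ∈ U` and the size of `β` at most `C`. -/
def paramSpace (R : Constraint) (d : ℕ) (U : Set ℝ) (C : ℝ) :
    Set (ℝ × EuclideanSpace ℝ (Fin d)) :=
  {θ | θ.1 ∈ U ∧ R.size θ.2 ≤ C}

end Constraint

end PanIC

/-! Up to a term in the response alone, each loss is a convex function of the linear predictor,
hence of the parameter. Let `θ₀` minimise the expected risk over a compact convex set. The empirical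
risk lies above its tangent plane at `θ₀`, whose coefficients are finitely many sample means: of the
loss, of its derivative, and of the derivative times each coordinate of `X`. Chebyshev puts each
within `O_P(n^{-1/2})` of its expectation, and first-order optimality makes the limiting slope
nonnegative towards every point of the set. So the minimal empirical risk is at least the minimal
expected risk minus `O_P(n^{-1/2})`; evaluating at `θ₀` gives the matching upper bound. No uniform
limit theorem is needed (`IsRegularLoss.exists_lower_bound_of_convex`).

The set `U` need not be convex. `exists_compact_convex_cover` enlarges it to two compact intervals
on which the same lower bound for the expected risk holds.

Consistency follows from the penalties (`tendsto_measure_minArgmin_ne`): they vanish, so a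
suboptimal model loses by a fixed margin, and between tied models the `√n`-scaled penalty gap beats
the bounded fluctuation. The response-only term shifts every model's risk equally and drops out. -/

namespace PanIC

/-! ### Boundedness in probability and `√n`-rates of sample means. -/

section Probability

variable {Ω 𝒵 : Type*} [MeasurableSpace Ω] {P : Measure Ω}

/-- The random variables `W n` are bounded above in probability, uniformly in `n`. -/
def BoundedInProb (P : Measure Ω) (W : ℕ → Ω → ℝ) : Prop :=
  ∀ ε : ENNReal, 0 < ε → ∃ M : ℝ, ∀ n, P {ω | M ≤ W n ω} ≤ ε

theorem BoundedInProb.add {W V : ℕ → Ω → ℝ} (hW : BoundedInProb P W) (hV : BoundedInProb P V) :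
    BoundedInProb P (fun n ω => W n ω + V n ω) := by
  intro ε hε
  obtain ⟨M, hM⟩ := hW (ε / 2) (ENNReal.half_pos hε.ne')
  obtain ⟨N, hN⟩ := hV (ε / 2) (ENNReal.half_pos hε.ne')
  refine ⟨M + N, fun n => ?_⟩
  calc P {ω | M + N ≤ W n ω + V n ω} ≤ P ({ω | M ≤ W n ω} ∪ {ω | N ≤ V n ω}) := by
        refine measure_mono fun ω hω => ?_
        simp only [Set.mem_union, Set.mem_ofPred_eq] at hω ⊢
        by_contra! h
        linarith
    _ ≤ ε / 2 + ε / 2 := (measure_union_le _ _).trans (add_le_add (hM n) (hN n))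
    _ = ε := ENNReal.add_halves ε

theorem BoundedInProb.max {W V : ℕ → Ω → ℝ} (hW : BoundedInProb P W) (hV : BoundedInProb P V) :
    BoundedInProb P (fun n ω => max (W n ω) (V n ω)) := by
  intro ε hε
  obtain ⟨M, hM⟩ := hW (ε / 2) (ENNReal.half_pos hε.ne')
  obtain ⟨N, hN⟩ := hV (ε / 2) (ENNReal.half_pos hε.ne')
  refine ⟨Max.max M N, fun n => ?_⟩
  calc P {ω | Max.max M N ≤ Max.max (W n ω) (V n ω)}
      ≤ P ({ω | M ≤ W n ω} ∪ {ω | N ≤ V n ω}) :=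
        measure_mono fun ω hω => (le_max_iff.1 hω).imp
          (fun h => (le_max_left M N).trans h) (fun h => (le_max_right M N).trans h)
    _ ≤ ε / 2 + ε / 2 := (measure_union_le _ _).trans (add_le_add (hM n) (hN n))
    _ = ε := ENNReal.add_halves ε

theorem BoundedInProb.zero : BoundedInProb P (fun _ _ => 0) := by
  intro ε _
  exact ⟨1, fun n => by simp [not_le.2 (zero_lt_one' ℝ)]⟩

theorem BoundedInProb.sum {ι : Type*} (s : Finset ι) {W : ι → ℕ → Ω → ℝ}
    (hW : ∀ i ∈ s, BoundedInProb P (W i)) :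
    BoundedInProb P (fun n ω => ∑ i ∈ s, W i n ω) := by
  classical
  induction s using Finset.induction_on with
  | empty => simpa using BoundedInProb.zero
  | insert i s hi ih =>
    simp only [Finset.sum_insert hi]
    exact (hW i (Finset.mem_insert_self i s)).add
      (ih fun j hj => hW j (Finset.mem_insert_of_mem hj))

theorem BoundedInProb.const_mul {W : ℕ → Ω → ℝ} (hW : BoundedInProb P W) {c : ℝ} (hc : 0 ≤ c) :
    BoundedInProb P (fun n ω => c * W n ω) := by
  rcases hc.eq_or_lt with rfl | hc
  · simpa using BoundedInProb.zero
  intro ε hε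
  obtain ⟨M, hM⟩ := hW ε hε
  exact ⟨c * M, fun n => by simpa only [mul_le_mul_iff_right₀ hc] using hM n⟩

/-- The average of `f` over the first `n` observations. -/
noncomputable def sampleMean (Z : ℕ → Ω → 𝒵) (n : ℕ) (f : 𝒵 → ℝ) (ω : Ω) : ℝ :=
  (1 / (n : ℝ)) * ∑ i ∈ Finset.range n, f (Z i ω)

omit [MeasurableSpace Ω] in
theorem sampleMean_add (Z : ℕ → Ω → 𝒵) (n : ℕ) (f g : 𝒵 → ℝ) (ω : Ω) :
    sampleMean Z n (fun z => f z + g z) ω = sampleMean Z n f ω + sampleMean Z n g ω := by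
  simp only [sampleMean, Finset.sum_add_distrib, mul_add]

omit [MeasurableSpace Ω] in
theorem sampleMean_const_mul (Z : ℕ → Ω → 𝒵) (n : ℕ) (c : ℝ) (f : 𝒵 → ℝ) (ω : Ω) :
    sampleMean Z n (fun z => c * f z) ω = c * sampleMean Z n f ω := by
  simp only [sampleMean, ← Finset.mul_sum]
  ring

omit [MeasurableSpace Ω] in
theorem sampleMean_sum {ι : Type*} (s : Finset ι) (Z : ℕ → Ω → 𝒵) (n : ℕ) (f : ι → 𝒵 → ℝ)
    (ω : Ω) : sampleMean Z n (fun z => ∑ j ∈ s, f j z) ω = ∑ j ∈ s, sampleMean Z n (f j) ω := by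
  simp only [sampleMean, Finset.mul_sum]
  exact Finset.sum_comm

omit [MeasurableSpace Ω] in
theorem sampleMean_mono {Z : ℕ → Ω → 𝒵} {n : ℕ} {f g : 𝒵 → ℝ} {ω : Ω}
    (h : ∀ i, f (Z i ω) ≤ g (Z i ω)) : sampleMean Z n f ω ≤ sampleMean Z n g ω :=
  mul_le_mul_of_nonneg_left (Finset.sum_le_sum fun i _ => h i) (by positivity)

/-- Chebyshev: the variance of the mean is `σ / n`, so the threshold `M / √n` gives the bound `σ / M
^ 2`, free of `n`. -/
theorem boundedInProb_sampleMean [IsProbabilityMeasure P] [MeasurableSpace 𝒵] {Z : ℕ → Ω → 𝒵}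
    (hindep : iIndepFun Z P) (hident : ∀ i, IdentDistrib (Z i) (Z 0) P P)
    {f : 𝒵 → ℝ} (hf : Measurable f) (hL2 : MemLp (fun ω => f (Z 0 ω)) 2 P) :
    BoundedInProb P
      (fun n ω => √n * |sampleMean Z n f ω - ∫ ω', f (Z 0 ω') ∂P|) := by
  intro ε hε
  set σ := Var[fun ω => f (Z 0 ω); P] with hσ
  have hid : ∀ i, IdentDistrib (fun ω => f (Z i ω)) (fun ω => f (Z 0 ω)) P P :=
    fun i => (hident i).comp hf
  have hmem : ∀ i, MemLp (fun ω => f (Z i ω)) 2 P := fun i => (hid i).symm.memLp_snd hL2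
  have hlim : Tendsto (fun M : ℝ => ENNReal.ofReal (σ / M ^ 2)) atTop (𝓝 0) := by
    rw [← ENNReal.ofReal_zero]
    refine ENNReal.tendsto_ofReal ?_
    exact tendsto_const_nhds.div_atTop (tendsto_pow_atTop two_ne_zero)
  obtain ⟨M, hM, hM0⟩ := ((hlim.eventually (gt_mem_nhds hε)).and (eventually_gt_atTop 0)).exists
  refine ⟨M, fun n => ?_⟩
  -- For `n = 0` the scaled deviation is `0`, and `M > 0` makes the event empty.
  rcases Nat.eq_zero_or_pos n with rfl | hn
  · have : {ω : Ω | M ≤ √((0 : ℕ) : ℝ) * |sampleMean Z 0 f ω - ∫ ω', f (Z 0 ω') ∂P|} = ∅ := by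
      ext ω
      simp [hM0]
    rw [this]
    simp
  have hn' : (0 : ℝ) < n := by exact_mod_cast hn
  have hs : MemLp (sampleMean Z n f) 2 P :=
    (memLp_finsetSum (Finset.range n) fun i _ => hmem i).const_mul (1 / (n : ℝ))
  have hmean : ∫ ω, sampleMean Z n f ω ∂P = ∫ ω', f (Z 0 ω') ∂P := by
    simp only [sampleMean]
    rw [integral_const_mul, integral_finsetSum _ fun i _ => (hmem i).integrable (by norm_num)]
    simp only [fun i => (hid i).integral_eq, Finset.sum_const, Finset.card_range, nsmul_eq_mul]
    field_simp
  have hvar : Var[sampleMean Z n f; P] = σ / n := by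
    have h1 : Var[fun ω => ∑ i ∈ Finset.range n, f (Z i ω); P] = n * σ := by
      have := IndepFun.variance_sum (μ := P) (X := fun i ω => f (Z i ω)) (s := Finset.range n)
        (fun i _ => hmem i)
        (fun i _ j _ hij => (hindep.indepFun hij).comp hf hf)
      have h2 : (fun ω => ∑ i ∈ Finset.range n, f (Z i ω))
          = ∑ i ∈ Finset.range n, (fun ω => f (Z i ω)) := by
        ext ω; simp
      rw [h2, this]
      simp only [fun i => (hid i).variance_eq, Finset.sum_const, Finset.card_range, nsmul_eq_mul]
      rfl
    have h3 : sampleMean Z n f = fun ω => (1 / (n : ℝ)) * ∑ i ∈ Finset.range n, f (Z i ω) := rfl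
    rw [h3, variance_const_mul, h1]
    field_simp
  have hsq : (0 : ℝ) < √n := Real.sqrt_pos.2 hn'
  have hch := meas_ge_le_variance_div_sq hs (c := M / √n) (by positivity)
  rw [hmean, hvar, div_pow, Real.sq_sqrt hn'.le] at hch
  have he : σ / n / (M ^ 2 / n) = σ / M ^ 2 := by field_simp
  rw [he] at hch
  refine le_trans (le_of_eq ?_) (hch.trans hM.le)
  congr 1
  ext ω
  simp only [Set.mem_ofPred_eq]
  rw [div_le_iff₀' hsq]

end Probability

/-! ### Convex losses of a linear predictor -/

section LinearPredictor

variable {d : ℕ}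

/-- The linear predictor `β₀ + βᵀ x`. -/
noncomputable def linPred (θ : ℝ × EuclideanSpace ℝ (Fin d)) (x : EuclideanSpace ℝ (Fin d)) : ℝ :=
  θ.1 + inner ℝ θ.2 x

theorem linPred_add (θ v : ℝ × EuclideanSpace ℝ (Fin d)) (x : EuclideanSpace ℝ (Fin d)) :
    linPred (θ + v) x = linPred θ x + linPred v x := by
  simp only [linPred, Prod.fst_add, Prod.snd_add, inner_add_left]
  ring

theorem linPred_smul (t : ℝ) (v : ℝ × EuclideanSpace ℝ (Fin d)) (x : EuclideanSpace ℝ (Fin d)) :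
    linPred (t • v) x = t * linPred v x := by
  simp only [linPred, Prod.smul_fst, Prod.smul_snd, real_inner_smul_left, smul_eq_mul]
  ring

theorem linPred_sub (θ v : ℝ × EuclideanSpace ℝ (Fin d)) (x : EuclideanSpace ℝ (Fin d)) :
    linPred (θ - v) x = linPred θ x - linPred v x := by
  simp only [linPred, Prod.fst_sub, Prod.snd_sub, inner_sub_left]
  ring

theorem linPred_eq_sum (θ : ℝ × EuclideanSpace ℝ (Fin d)) (x : EuclideanSpace ℝ (Fin d)) :
    linPred θ x = θ.1 + ∑ j, θ.2 j * x j := by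
  simp only [linPred, PiLp.inner_apply, RCLike.inner_apply, conj_trivial]
  congr 1
  exact Finset.sum_congr rfl fun j _ => mul_comm _ _

@[fun_prop]
theorem continuous_linPred (θ : ℝ × EuclideanSpace ℝ (Fin d)) : Continuous (linPred θ) := by
  unfold linPred
  fun_prop

@[fun_prop]
theorem continuous_linPred_left (x : EuclideanSpace ℝ (Fin d)) :
    Continuous fun θ => linPred θ x := by
  unfold linPred
  fun_prop

/-- The function `ψ y` of the linear predictor is convex with continuous derivative `ψ' y` for
almost every response, and the loss and its gradient are square-integrable. -/
structure IsRegularLoss {Ω : Type*} [MeasurableSpace Ω] (P : Measure Ω)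
    (X : Ω → EuclideanSpace ℝ (Fin d)) (Y : Ω → ℝ) (ψ ψ' : ℝ → ℝ → ℝ) : Prop where
  measurable : Measurable fun p : ℝ × ℝ => ψ p.1 p.2
  measurable_deriv : Measurable fun p : ℝ × ℝ => ψ' p.1 p.2
  continuous : ∀ y, Continuous (ψ y)
  continuous_deriv : ∀ y, Continuous (ψ' y)
  -- Convexity is tied to a measurable set of responses so that equality in law carries it from `Y
  -- 0` to every `Y i`.
  tangent_on : ∃ S : Set ℝ, MeasurableSet S ∧ (∀ᵐ ω ∂P, Y ω ∈ S) ∧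
    ∀ y ∈ S, ∀ s t, ψ y s + ψ' y s * (t - s) ≤ ψ y t
  memLp : ∀ θ, MemLp (fun ω => ψ (Y ω) (linPred θ (X ω))) 2 P
  memLp_deriv : ∀ θ, MemLp (fun ω => ψ' (Y ω) (linPred θ (X ω))) 2 P
  memLp_deriv_mul : ∀ θ j, MemLp (fun ω => ψ' (Y ω) (linPred θ (X ω)) * X ω j) 2 P

/-- The expectation of the loss `ψ (y, β₀ + βᵀ x)`. -/
noncomputable def linRisk {Ω : Type*} [MeasurableSpace Ω] (P : Measure Ω)
    (X : Ω → EuclideanSpace ℝ (Fin d)) (Y : Ω → ℝ) (ψ : ℝ → ℝ → ℝ)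
    (θ : ℝ × EuclideanSpace ℝ (Fin d)) : ℝ :=
  ∫ ω, ψ (Y ω) (linPred θ (X ω)) ∂P

namespace IsRegularLoss

variable {Ω : Type*} [MeasurableSpace Ω] {P : Measure Ω} [IsProbabilityMeasure P]
  {X : Ω → EuclideanSpace ℝ (Fin d)} {Y : Ω → ℝ} {ψ ψ' : ℝ → ℝ → ℝ}

omit [IsProbabilityMeasure P] in
theorem tangent (h : IsRegularLoss P X Y ψ ψ') :
    ∀ᵐ ω ∂P, ∀ s t, ψ (Y ω) s + ψ' (Y ω) s * (t - s) ≤ ψ (Y ω) t := by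
  obtain ⟨S, -, hY, hS⟩ := h.tangent_on
  exact hY.mono fun ω hω => hS _ hω

theorem integrable (h : IsRegularLoss P X Y ψ ψ') (θ : ℝ × EuclideanSpace ℝ (Fin d)) :
    Integrable (fun ω => ψ (Y ω) (linPred θ (X ω))) P :=
  (h.memLp θ).integrable (by norm_num)

theorem integrable_deriv (h : IsRegularLoss P X Y ψ ψ') (θ : ℝ × EuclideanSpace ℝ (Fin d)) :
    Integrable (fun ω => ψ' (Y ω) (linPred θ (X ω))) P :=
  (h.memLp_deriv θ).integrable (by norm_num)

theorem integrable_deriv_mul (h : IsRegularLoss P X Y ψ ψ')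
    (θ : ℝ × EuclideanSpace ℝ (Fin d)) (j : Fin d) :
    Integrable (fun ω => ψ' (Y ω) (linPred θ (X ω)) * X ω j) P :=
  (h.memLp_deriv_mul θ j).integrable (by norm_num)

theorem mul_linPred (a : ℝ) (v : ℝ × EuclideanSpace ℝ (Fin d)) (x : EuclideanSpace ℝ (Fin d)) :
    a * linPred v x = v.1 * a + ∑ j, v.2 j * (a * x j) := by
  rw [linPred_eq_sum, mul_add, Finset.mul_sum, mul_comm a]
  congr 1
  exact Finset.sum_congr rfl fun j _ => by ring

theorem integrable_slope (h : IsRegularLoss P X Y ψ ψ') (θ v : ℝ × EuclideanSpace ℝ (Fin d)) :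
    Integrable (fun ω => ψ' (Y ω) (linPred θ (X ω)) * linPred v (X ω)) P := by
  simp only [mul_linPred]
  exact ((h.integrable_deriv θ).const_mul _).add
    (integrable_finsetSum _ fun j _ => (h.integrable_deriv_mul θ j).const_mul _)

theorem integral_slope (h : IsRegularLoss P X Y ψ ψ') (θ v : ℝ × EuclideanSpace ℝ (Fin d)) :
    ∫ ω, ψ' (Y ω) (linPred θ (X ω)) * linPred v (X ω) ∂P =
      v.1 * ∫ ω, ψ' (Y ω) (linPred θ (X ω)) ∂P +
        ∑ j, v.2 j * ∫ ω, ψ' (Y ω) (linPred θ (X ω)) * X ω j ∂P := by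
  simp only [mul_linPred]
  rw [integral_add ((h.integrable_deriv θ).const_mul _)
    (integrable_finsetSum _ fun j _ => (h.integrable_deriv_mul θ j).const_mul _),
    integral_const_mul,
    integral_finsetSum _ fun j _ => (h.integrable_deriv_mul θ j).const_mul _]
  simp only [integral_const_mul]

/-- The expected risk lies above its tangent planes. -/
theorem tangent_linRisk (h : IsRegularLoss P X Y ψ ψ') (θ v : ℝ × EuclideanSpace ℝ (Fin d)) :
    linRisk P X Y ψ θ + ∫ ω, ψ' (Y ω) (linPred θ (X ω)) * linPred v (X ω) ∂P
      ≤ linRisk P X Y ψ (θ + v) := by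
  unfold linRisk
  rw [← integral_add (h.integrable θ) (h.integrable_slope θ v)]
  refine integral_mono_ae ((h.integrable θ).add (h.integrable_slope θ v)) (h.integrable _) ?_
  filter_upwards [h.tangent] with ω hω
  have := hω (linPred θ (X ω)) (linPred (θ + v) (X ω))
  rwa [linPred_add, add_sub_cancel_left, ← linPred_add] at this

/-- The tangent plane at the convex combination bounds the risk at both endpoints from below; in the
weighted sum the two slopes cancel. -/
theorem convexOn_linRisk (h : IsRegularLoss P X Y ψ ψ') :
    ConvexOn ℝ Set.univ (linRisk P X Y ψ) := by
  refine ⟨convex_univ, fun θ₁ _ θ₂ _ a b ha hb hab => ?_⟩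
  set θ := a • θ₁ + b • θ₂ with hθ
  have h1 := h.tangent_linRisk θ (b • (θ₁ - θ₂))
  have h2 := h.tangent_linRisk θ (a • (θ₂ - θ₁))
  have e1 : θ + b • (θ₁ - θ₂) = θ₁ := by
    rw [hθ]
    have : a = 1 - b := by linarith
    rw [this]
    module
  have e2 : θ + a • (θ₂ - θ₁) = θ₂ := by
    rw [hθ]
    have : b = 1 - a := by linarith
    rw [this]
    module
  rw [e1] at h1
  rw [e2] at h2
  have e3 : ∀ ω, linPred (a • (θ₂ - θ₁)) (X ω) = -a * linPred (θ₁ - θ₂) (X ω) := by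
    intro ω
    rw [linPred_smul, linPred_sub, linPred_sub]
    ring
  simp only [linPred_smul, mul_left_comm _ b, integral_const_mul] at h1
  simp only [e3, mul_left_comm _ (-a), integral_const_mul] at h2
  simp only [smul_eq_mul]
  have hsum : a * linRisk P X Y ψ θ + b * linRisk P X Y ψ θ = linRisk P X Y ψ θ := by
    rw [← add_mul, hab, one_mul]
  linarith [mul_le_mul_of_nonneg_left h1 ha, mul_le_mul_of_nonneg_left h2 hb]

/-- A finite convex function on a finite-dimensional space is continuous, so no domination argument
is needed. -/
theorem continuous_linRisk (h : IsRegularLoss P X Y ψ ψ') : Continuous (linRisk P X Y ψ) := by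
  rw [← continuousOn_univ]
  exact h.convexOn_linRisk.continuousOn isOpen_univ

/-- First-order optimality of a minimiser of the expected risk over a convex set. -/
theorem integral_slope_nonneg (h : IsRegularLoss P X Y ψ ψ')
    {T : Set (ℝ × EuclideanSpace ℝ (Fin d))} (hT : Convex ℝ T)
    {θ₀ θ : ℝ × EuclideanSpace ℝ (Fin d)} (hθ₀ : θ₀ ∈ T) (hmin : IsMinOn (linRisk P X Y ψ) T θ₀)
    (hθ : θ ∈ T) :
    0 ≤ ∫ ω, ψ' (Y ω) (linPred θ₀ (X ω)) * linPred (θ - θ₀) (X ω) ∂P := by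
  set v := θ - θ₀ with hv
  set t : ℕ → ℝ := fun n => 1 / ((n : ℝ) + 1) with ht
  have htpos : ∀ n, 0 < t n := fun n => Nat.one_div_pos_of_nat
  have htle : ∀ n, t n ≤ 1 := fun n => by
    rw [ht]
    simp only
    rw [div_le_one (by positivity)]
    linarith [(Nat.cast_nonneg n : (0 : ℝ) ≤ n)]
  have htlim : Tendsto t atTop (𝓝 0) := tendsto_one_div_add_atTop_nhds_zero_nat
  have hmem : ∀ n, θ₀ + t n • v ∈ T := fun n =>
    hT.add_smul_sub_mem hθ₀ hθ ⟨(htpos n).le, htle n⟩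
  -- The tangent plane at `θ₀ + t n • v`, evaluated back at the minimiser `θ₀`, would drop strictly
  -- above the minimum if this slope were negative.
  have hpos : ∀ n, 0 ≤ ∫ ω, ψ' (Y ω) (linPred (θ₀ + t n • v) (X ω)) * linPred v (X ω) ∂P := by
    intro n
    have h1 := h.tangent_linRisk (θ₀ + t n • v) ((-t n) • v)
    have e1 : θ₀ + t n • v + (-t n) • v = θ₀ := by module
    rw [e1] at h1
    have h2 : linRisk P X Y ψ θ₀ ≤ linRisk P X Y ψ (θ₀ + t n • v) := hmin (hmem n)
    simp only [linPred_smul, mul_left_comm _ (-t n), integral_const_mul] at h1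
    by_contra! hneg
    nlinarith [mul_pos (htpos n) (neg_pos.2 hneg)]
  -- By convexity the slope along `v` is monotone in the step, so for steps in `[0, 1]` it lies
  -- between its values at `θ₀` and `θ₀ + v`; these two dominate.
  refine ge_of_tendsto' (tendsto_integral_of_dominated_convergence
    (fun ω => |ψ' (Y ω) (linPred θ₀ (X ω)) * linPred v (X ω)| +
      |ψ' (Y ω) (linPred (θ₀ + v) (X ω)) * linPred v (X ω)|)
    (fun n => (h.integrable_slope (θ₀ + t n • v) v).aestronglyMeasurable)
    ((h.integrable_slope _ _).abs.add (h.integrable_slope _ _).abs) (fun n => ?_) ?_) hpos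
  · filter_upwards [h.tangent] with ω hω
    have key : ∀ a b c : ℝ, 0 < c → ψ' (Y ω) a * (c * b) ≤ ψ' (Y ω) (a + c * b) * (c * b) := by
      intro a b c _
      have h1 := hω a (a + c * b)
      have h2 := hω (a + c * b) a
      linarith
    have key' : ∀ a b c : ℝ, 0 < c → ψ' (Y ω) a * b ≤ ψ' (Y ω) (a + c * b) * b := by
      intro a b c hc
      have := key a b c hc
      by_contra! hlt
      nlinarith
    rw [linPred_add, linPred_smul, linPred_add]
    set a := linPred θ₀ (X ω)
    set b := linPred v (X ω)
    have hlow := key' a b (t n) (htpos n)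
    have hup : ψ' (Y ω) (a + t n * b) * b ≤ ψ' (Y ω) (a + b) * b := by
      rcases (htle n).eq_or_lt with h1 | h1
      · rw [h1, one_mul]
      · have := key' (a + t n * b) b (1 - t n) (by linarith)
        rwa [show a + t n * b + (1 - t n) * b = a + b by ring] at this
    rw [Real.norm_eq_abs, abs_le]
    constructor
    · linarith [neg_abs_le (ψ' (Y ω) a * b), abs_nonneg (ψ' (Y ω) (a + b) * b)]
    · linarith [le_abs_self (ψ' (Y ω) (a + b) * b), abs_nonneg (ψ' (Y ω) a * b)]
  · refine Eventually.of_forall fun ω => ?_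
    have hc : Continuous fun s : ℝ => ψ' (Y ω) (linPred (θ₀ + s • v) (X ω)) * linPred v (X ω) := by
      have := h.continuous_deriv (Y ω)
      simp only [linPred_add, linPred_smul]
      fun_prop
    have := (hc.tendsto 0).comp htlim
    simpa [Function.comp_def] using this

end IsRegularLoss

end LinearPredictor

end PanIC

namespace PanIC

/-! ### Lower bounds for the minimal empirical risk. -/

section EmpiricalMinimum

variable {Ω : Type*} [MeasurableSpace Ω] {P : Measure Ω} [IsProbabilityMeasure P] {d : ℕ}
  {X : ℕ → Ω → EuclideanSpace ℝ (Fin d)} {Y : ℕ → Ω → ℝ} {ψ ψ' : ℝ → ℝ → ℝ}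

/-- Over a bounded convex set, the empirical risk stays above the minimal expected risk up to a
term of order `n ^ (-1/2)` in probability. -/
theorem IsRegularLoss.exists_lower_bound_of_convex (h : IsRegularLoss P (X 0) (Y 0) ψ ψ')
    (hindep : iIndepFun (fun i ω => (X i ω, Y i ω)) P)
    (hident : ∀ i, IdentDistrib (fun ω => (X i ω, Y i ω)) (fun ω => (X 0 ω, Y 0 ω)) P P)
    {T : Set (ℝ × EuclideanSpace ℝ (Fin d))} (hT : Convex ℝ T) (hb : Bornology.IsBounded T)
    {θ₀ : ℝ × EuclideanSpace ℝ (Fin d)} (hθ₀ : θ₀ ∈ T)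
    (hmin : IsMinOn (linRisk P (X 0) (Y 0) ψ) T θ₀) :
    ∃ W : ℕ → Ω → ℝ, BoundedInProb P W ∧ ∀ᵐ ω ∂P, ∀ n, ∀ θ ∈ T,
      -W n ω ≤ √n * (sampleMean (fun i ω => (X i ω, Y i ω)) n
        (fun z => ψ z.2 (linPred θ z.1)) ω - linRisk P (X 0) (Y 0) ψ θ₀) := by
  set Z : ℕ → Ω → EuclideanSpace ℝ (Fin d) × ℝ := fun i ω => (X i ω, Y i ω) with hZ
  have hlin : Measurable fun z : EuclideanSpace ℝ (Fin d) × ℝ => linPred θ₀ z.1 :=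
    (continuous_linPred θ₀).measurable.comp measurable_fst
  have m0 : Measurable fun z : EuclideanSpace ℝ (Fin d) × ℝ => ψ z.2 (linPred θ₀ z.1) :=
    h.measurable.comp (measurable_snd.prodMk hlin)
  have m1 : Measurable fun z : EuclideanSpace ℝ (Fin d) × ℝ => ψ' z.2 (linPred θ₀ z.1) :=
    h.measurable_deriv.comp (measurable_snd.prodMk hlin)
  have m2 : ∀ j, Measurable fun z : EuclideanSpace ℝ (Fin d) × ℝ =>
      ψ' z.2 (linPred θ₀ z.1) * z.1 j := fun j => m1.mul (by fun_prop)
  have b0 := boundedInProb_sampleMean hindep hident m0 (h.memLp θ₀)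
  have b1 := boundedInProb_sampleMean hindep hident m1 (h.memLp_deriv θ₀)
  have b2 := fun j => boundedInProb_sampleMean hindep hident (m2 j) (h.memLp_deriv_mul θ₀ j)
  set a := ∫ ω, ψ' (Y 0 ω) (linPred θ₀ (X 0 ω)) ∂P with ha
  set b : Fin d → ℝ := fun j => ∫ ω, ψ' (Y 0 ω) (linPred θ₀ (X 0 ω)) * X 0 ω j ∂P with hbdef
  have hD : (0 : ℝ) ≤ Metric.diam T := Metric.diam_nonneg
  refine ⟨_, b0.add ((b1.add (BoundedInProb.sum Finset.univ fun j _ => b2 j)).const_mul hD), ?_⟩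
  obtain ⟨S, hSm, hYS, hS⟩ := h.tangent_on
  have hall : ∀ᵐ ω ∂P, ∀ i, Y i ω ∈ S := by
    rw [ae_all_iff]
    intro i
    exact ((hident i).comp measurable_snd).symm.ae_snd hSm hYS
  filter_upwards [hall] with ω hω n θ hθ
  set v := θ - θ₀ with hv
  have hvn : ‖v‖ ≤ Metric.diam T := by
    rw [hv, ← dist_eq_norm]
    exact Metric.dist_le_diam_of_mem hb hθ hθ₀
  have hv1 : |v.1| ≤ Metric.diam T := (norm_fst_le v).trans hvn
  have hv2 : ∀ j, |v.2 j| ≤ Metric.diam T := fun j =>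
    ((PiLp.norm_apply_le v.2 j).trans (norm_snd_le v)).trans hvn
  -- Only here does the minimality of `θ₀` enter: the expected slope towards `θ` can be dropped,
  -- leaving the fluctuations of the coefficients.
  have hfirst := h.integral_slope_nonneg hT hθ₀ hmin hθ
  rw [h.integral_slope] at hfirst
  have hmean : sampleMean Z n (fun z => ψ z.2 (linPred θ₀ z.1)) ω +
      (v.1 * sampleMean Z n (fun z => ψ' z.2 (linPred θ₀ z.1)) ω +
        ∑ j, v.2 j * sampleMean Z n (fun z => ψ' z.2 (linPred θ₀ z.1) * z.1 j) ω) ≤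
      sampleMean Z n (fun z => ψ z.2 (linPred θ z.1)) ω := by
    simp only [← sampleMean_const_mul, ← sampleMean_sum, ← sampleMean_add]
    refine sampleMean_mono fun i => ?_
    have := hS _ (hω i) (linPred θ₀ (X i ω)) (linPred θ (X i ω))
    rw [← linPred_sub, IsRegularLoss.mul_linPred] at this
    exact this
  set A0 := sampleMean Z n (fun z => ψ z.2 (linPred θ₀ z.1)) ω
  set A1 := sampleMean Z n (fun z => ψ' z.2 (linPred θ₀ z.1)) ω
  set A2 : Fin d → ℝ := fun j => sampleMean Z n (fun z => ψ' z.2 (linPred θ₀ z.1) * z.1 j) ω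
  have hn : 0 ≤ √(n : ℝ) := Real.sqrt_nonneg _
  set r₀ := linRisk P (X 0) (Y 0) ψ θ₀ with hr₀
  have key : ∀ c x : ℝ, |c| ≤ Metric.diam T → -(Metric.diam T * (√n * |x|)) ≤ √n * (c * x) := by
    intro c x hc
    have h1 : |c * x| ≤ Metric.diam T * |x| := by
      rw [abs_mul]
      exact mul_le_mul_of_nonneg_right hc (abs_nonneg x)
    have h2 := mul_le_mul_of_nonneg_left ((neg_le_neg h1).trans (neg_abs_le (c * x))) hn
    linarith
  have k0 : -(√n * |A0 - r₀|) ≤ √n * (A0 - r₀) := by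
    have := mul_le_mul_of_nonneg_left (neg_abs_le (A0 - r₀)) hn
    linarith
  have k1 := key v.1 (A1 - a) hv1
  have k2 : -(Metric.diam T * ∑ j, √n * |A2 j - b j|) ≤ √n * ∑ j, v.2 j * (A2 j - b j) := by
    rw [Finset.mul_sum, Finset.mul_sum, ← Finset.sum_neg_distrib]
    exact Finset.sum_le_sum fun j _ => key _ _ (hv2 j)
  have k3 : ∑ j, v.2 j * (A2 j - b j) = ∑ j, v.2 j * A2 j - ∑ j, v.2 j * b j := by
    rw [← Finset.sum_sub_distrib]
    exact Finset.sum_congr rfl fun j _ => mul_sub _ _ _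
  have k4 : √n * ((A0 - r₀) + v.1 * (A1 - a) + ∑ j, v.2 j * (A2 j - b j)) ≤
      √n * (sampleMean Z n (fun z => ψ z.2 (linPred θ z.1)) ω - r₀) := by
    refine mul_le_mul_of_nonneg_left ?_ hn
    rw [k3, mul_sub]
    linarith
  have goal : -(√n * |A0 - r₀| + Metric.diam T * (√n * |A1 - a| + ∑ j, √n * |A2 j - b j|)) ≤
      √n * (sampleMean Z n (fun z => ψ z.2 (linPred θ z.1)) ω - r₀) := by
    linarith
  exact goal

/-- If a convex function is at least `v` on `U ×ˢ B`, then so it is on `(I ∪ J) ×ˢ B` for suitable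
compact intervals `I` and `J` covering `U`. -/
theorem exists_compact_convex_cover {E : Type*} [AddCommGroup E] [Module ℝ E] [TopologicalSpace E]
    {f : ℝ × E → ℝ} (hf : ConvexOn ℝ Set.univ f) (hc : Continuous f)
    {U : Set ℝ} (hU : IsCompact U) {B : Set E} (hB : Convex ℝ B) {v : ℝ}
    (hv : ∀ b ∈ U, ∀ β ∈ B, v ≤ f (b, β)) :
    ∃ I J : Set ℝ, IsCompact I ∧ Convex ℝ I ∧ IsCompact J ∧ Convex ℝ J ∧ U ⊆ I ∪ J ∧
      ∀ b ∈ I ∪ J, ∀ β ∈ B, v ≤ f (b, β) := by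
  -- The bad intercepts form the projection of a convex set, hence an open interval, which `U`
  -- avoids; what remains on either side of it is an interval.
  set N : Set ℝ := {b | ∃ β ∈ B, f (b, β) < v} with hN
  have hNo : IsOpen N := by
    have : N = ⋃ β ∈ B, {b | f (b, β) < v} := by
      ext b; simp [hN]
    rw [this]
    exact isOpen_biUnion fun β _ => isOpen_lt (by fun_prop) continuous_const
  have hNc : Convex ℝ N := by
    rintro b₁ ⟨β₁, h₁, h₁'⟩ b₂ ⟨β₂, h₂, h₂'⟩ s t hs ht hst
    refine ⟨s • β₁ + t • β₂, hB h₁ h₂ hs ht hst, ?_⟩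
    have := (hf.convex_lt v) ⟨Set.mem_univ (b₁, β₁), h₁'⟩ ⟨Set.mem_univ (b₂, β₂), h₂'⟩ hs ht hst
    exact this.2
  have hNord := hNc.ordConnected
  -- The cut point lies in `N` whenever possible; if `N` is empty any value serves, and `0` is
  -- taken.
  obtain ⟨c, hcN⟩ : ∃ c, N.Nonempty → c ∈ N := by
    by_cases h : N.Nonempty
    · exact ⟨h.some, fun _ => h.some_mem⟩
    · exact ⟨0, fun h' => (h h').elim⟩
  obtain ⟨l, hl⟩ := hU.bddBelow
  obtain ⟨u, hu⟩ := hU.bddAbove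
  refine ⟨Set.Icc l u ∩ Set.Iic c ∩ Nᶜ, Set.Icc l u ∩ Set.Ici c ∩ Nᶜ,
    (isCompact_Icc.inter_right isClosed_Iic).inter_right hNo.isClosed_compl, ?_,
    (isCompact_Icc.inter_right isClosed_Ici).inter_right hNo.isClosed_compl, ?_, ?_, ?_⟩
  -- A point `z ∈ N` between `x` and `y`, both at most `c`, would force `[z, c]`, and so `y`, into
  -- `N`.
  · refine Set.OrdConnected.convex ⟨?_⟩
    rintro x ⟨⟨hx, hxc⟩, hxN⟩ y ⟨⟨hy, hyc⟩, hyN⟩ z hz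
    refine ⟨⟨⟨hx.1.trans hz.1, hz.2.trans hy.2⟩, hz.2.trans hyc⟩, fun hzN => hyN ?_⟩
    exact hNord.out hzN (hcN ⟨z, hzN⟩) ⟨hz.2, hyc⟩
  · refine Set.OrdConnected.convex ⟨?_⟩
    rintro x ⟨⟨hx, hxc⟩, hxN⟩ y ⟨⟨hy, hyc⟩, hyN⟩ z hz
    refine ⟨⟨⟨hx.1.trans hz.1, hz.2.trans hy.2⟩, le_trans hxc hz.1⟩, fun hzN => hxN ?_⟩
    exact hNord.out (hcN ⟨z, hzN⟩) hzN ⟨hxc, hz.1⟩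
  · intro b hb
    have hbN : b ∉ N := by
      rintro ⟨β, hβ, hlt⟩
      exact absurd hlt (not_lt.2 (hv b hb β hβ))
    rcases le_total b c with h | h
    · exact Or.inl ⟨⟨⟨hl hb, hu hb⟩, h⟩, hbN⟩
    · exact Or.inr ⟨⟨⟨hl hb, hu hb⟩, h⟩, hbN⟩
  · rintro b hb β hβ
    have hbN : b ∉ N := by
      rcases hb with hb | hb <;> exact hb.2
    by_contra! hlt
    exact hbN ⟨β, hβ, hlt⟩

/-- Convexity of `U` is dispensed with by applying the convex case to each of the two intervals of
the cover. The minimal expected risk on a piece is still at least `v`, which only helps. -/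
theorem IsRegularLoss.exists_lower_bound (h : IsRegularLoss P (X 0) (Y 0) ψ ψ')
    (hindep : iIndepFun (fun i ω => (X i ω, Y i ω)) P)
    (hident : ∀ i, IdentDistrib (fun ω => (X i ω, Y i ω)) (fun ω => (X 0 ω, Y 0 ω)) P P)
    {U : Set ℝ} (hU : IsCompact U) {B : Set (EuclideanSpace ℝ (Fin d))} (hBc : IsCompact B)
    (hB : Convex ℝ B) {v : ℝ} (hv : ∀ θ ∈ U ×ˢ B, v ≤ linRisk P (X 0) (Y 0) ψ θ) :
    ∃ W : ℕ → Ω → ℝ, BoundedInProb P W ∧ ∀ᵐ ω ∂P, ∀ n, ∀ θ ∈ U ×ˢ B,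
      -W n ω ≤ √n * (sampleMean (fun i ω => (X i ω, Y i ω)) n
        (fun z => ψ z.2 (linPred θ z.1)) ω - v) := by
  obtain ⟨I, J, hIc, hI, hJc, hJ, hUIJ, hIJ⟩ :=
    exists_compact_convex_cover h.convexOn_linRisk h.continuous_linRisk hU hB
      (v := v) fun b hb β hβ => hv (b, β) ⟨hb, hβ⟩
  have piece : ∀ K : Set ℝ, IsCompact K → Convex ℝ K → K ⊆ I ∪ J →
      ∃ W : ℕ → Ω → ℝ, BoundedInProb P W ∧ (∀ n ω, 0 ≤ W n ω) ∧ ∀ᵐ ω ∂P, ∀ n, ∀ θ ∈ K ×ˢ B,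
        -W n ω ≤ √n * (sampleMean (fun i ω => (X i ω, Y i ω)) n
          (fun z => ψ z.2 (linPred θ z.1)) ω - v) := by
    intro K hKc hK hKIJ
    rcases (K ×ˢ B).eq_empty_or_nonempty with he | hne
    · exact ⟨_, BoundedInProb.zero, fun _ _ => le_rfl, by simp [he]⟩
    obtain ⟨θ₀, hθ₀, hmin⟩ :=
      (hKc.prod hBc).exists_isMinOn hne h.continuous_linRisk.continuousOn
    obtain ⟨W, hW, hWb⟩ := h.exists_lower_bound_of_convex hindep hident (hK.prod hB)
      (hKc.prod hBc).isBounded hθ₀ hmin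
    -- Truncation at `0` lets the sum of the two pieces' bounds dominate either one.
    refine ⟨fun n ω => max (W n ω) 0, hW.max BoundedInProb.zero, fun _ _ => le_max_right _ _, ?_⟩
    filter_upwards [hWb] with ω hω n θ hθ
    have h1 := hω n θ hθ
    have h2 : v ≤ linRisk P (X 0) (Y 0) ψ θ₀ := hIJ θ₀.1 (hKIJ hθ₀.1) θ₀.2 hθ₀.2
    have h3 := mul_le_mul_of_nonneg_left h2 (Real.sqrt_nonneg (n : ℝ))
    have h4 := le_max_left (W n ω) 0
    linarith
  obtain ⟨W₁, hW₁, hp₁, hb₁⟩ := piece I hIc hI Set.subset_union_left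
  obtain ⟨W₂, hW₂, hp₂, hb₂⟩ := piece J hJc hJ Set.subset_union_right
  refine ⟨_, hW₁.add hW₂, ?_⟩
  filter_upwards [hb₁, hb₂] with ω h1 h2 n θ hθ
  rcases hUIJ hθ.1 with hI' | hJ'
  · linarith [h1 n θ ⟨hI', hθ.2⟩, hp₂ n ω]
  · linarith [h2 n θ ⟨hJ', hθ.2⟩, hp₁ n ω]

end EmpiricalMinimum

/-! ### Consistency of penalised selection -/

section Selection

theorem minArgmin_le {m : ℕ} [NeZero m] (v : Fin m → ℝ) (j : Fin m) :
    v (minArgmin v) ≤ v j := by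
  have := Finset.min'_mem (argmin v) (argmin_nonempty v)
  simp only [argmin, Finset.mem_filter, Finset.mem_univ, true_and] at this
  exact this j

theorem lt_of_lt_minArgmin {m : ℕ} [NeZero m] (v : Fin m → ℝ) {j : Fin m}
    (hj : j < minArgmin v) : v (minArgmin v) < v j := by
  by_contra! h
  have hmem : j ∈ argmin v := by
    simp only [argmin, Finset.mem_filter, Finset.mem_univ, true_and]
    exact fun i => h.trans (minArgmin_le v i)
  exact absurd (Finset.min'_le _ _ hmem) (not_le.2 hj)

variable {Ω : Type*} [MeasurableSpace Ω] {P : Measure Ω}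

theorem BoundedInProb.tendsto_measure {W : ℕ → Ω → ℝ} (hW : BoundedInProb P W) {a : ℕ → ℝ}
    (ha : Tendsto a atTop atTop) : Tendsto (fun n => P {ω | a n ≤ W n ω}) atTop (𝓝 0) := by
  rw [ENNReal.tendsto_nhds_zero]
  intro ε hε
  obtain ⟨M, hM⟩ := hW ε hε
  filter_upwards [ha.eventually_ge_atTop M] with n hn
  exact (measure_mono fun ω hω => le_trans hn hω).trans (hM n)

/-- The centring `c` is common to all models, so it cancels when two criteria are compared and needs
no rate. A union bound over the finitely many wrong indices reduces to a single one. -/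
theorem tendsto_measure_minArgmin_ne {m : ℕ} [NeZero m] {pen : Fin m → ℕ → Ω → ℝ}
    (hpen : IsPenalty P pen) {s : Fin m → ℕ → Ω → ℝ} {S : Fin m → ℝ} {c : ℕ → Ω → ℝ}
    {W : Fin m → ℕ → Ω → ℝ} (hW : ∀ k, BoundedInProb P (W k))
    (hs : ∀ k, ∀ᵐ ω ∂P, ∀ n : ℕ, √n * |s k n ω - c n ω - S k| ≤ W k n ω) :
    Tendsto (fun n => P {ω | minArgmin (fun k => s k n ω + pen k n ω) ≠ minArgmin S})
      atTop (𝓝 0) := by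
  set k₀ := minArgmin S with hk₀
  have hdiff : ∀ k, ∀ᵐ ω ∂P, ∀ n, s k n ω + pen k n ω ≤ s k₀ n ω + pen k₀ n ω →
      √n * (S k - S k₀) + √n * (pen k n ω - pen k₀ n ω) ≤ W k n ω + W k₀ n ω := by
    intro k
    filter_upwards [hs k, hs k₀] with ω h1 h2 n hle
    have hn : 0 ≤ √(n : ℝ) := Real.sqrt_nonneg _
    have e1 := mul_le_mul_of_nonneg_left (neg_abs_le (s k n ω - c n ω - S k)) hn
    have e2 := mul_le_mul_of_nonneg_left (le_abs_self (s k₀ n ω - c n ω - S k₀)) hn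
    have e3 := mul_le_mul_of_nonneg_left hle hn
    linarith [h1 n, h2 n]
  have hsqrt : Tendsto (fun n : ℕ => √(n : ℝ)) atTop atTop :=
    Real.tendsto_sqrt_atTop.comp tendsto_natCast_atTop_atTop
  have hk : ∀ k ∈ Finset.univ.erase k₀,
      Tendsto (fun n => P {ω | minArgmin (fun k => s k n ω + pen k n ω) = k}) atTop (𝓝 0) := by
    intro k hk
    have hne : k ≠ k₀ := Finset.ne_of_mem_erase hk
    have hsel : ∀ n, ∀ ω, minArgmin (fun k => s k n ω + pen k n ω) = k →
        s k n ω + pen k n ω ≤ s k₀ n ω + pen k₀ n ω := by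
      rintro n ω rfl
      exact minArgmin_le (fun k => s k n ω + pen k n ω) k₀
    -- In a tie `k₀` is the smaller index, so the penalty gap decides; otherwise the risk gap `δ`
    -- does.
    rcases (minArgmin_le S k).eq_or_lt with heq | hlt
    · have hlt : k₀ < k := by
        rcases lt_or_gt_of_ne hne with h | h
        · exact absurd heq (lt_of_lt_minArgmin S h).ne
        · exact h
      rw [ENNReal.tendsto_nhds_zero]
      intro ε hε
      obtain ⟨M, hM⟩ := ((hW k).add (hW k₀)) (ε / 2) (ENNReal.half_pos hε.ne')
      have hgap := (ENNReal.tendsto_nhds_zero.1 (hpen.gap k₀ k hlt M)) (ε / 2)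
        (ENNReal.half_pos hε.ne')
      filter_upwards [hgap] with n hn
      calc P {ω | minArgmin (fun k => s k n ω + pen k n ω) = k}
          ≤ P ({ω | √n * (pen k n ω - pen k₀ n ω) ≤ M} ∪ {ω | M ≤ W k n ω + W k₀ n ω}) := by
            refine measure_mono_ae ?_
            filter_upwards [hdiff k] with ω hω hmem
            have := hω n (hsel n ω hmem)
            rw [show S k - S k₀ = 0 from sub_eq_zero.2 heq.symm, mul_zero, zero_add] at this
            rcases le_total (√n * (pen k n ω - pen k₀ n ω)) M with h | h
            · exact Or.inl h
            · exact Or.inr (h.trans this)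
        _ ≤ ε / 2 + ε / 2 := (measure_union_le _ _).trans (add_le_add hn (hM n))
        _ = ε := ENNReal.add_halves ε
    · set δ := S k - S k₀ with hδ
      have hδpos : 0 < δ := sub_pos.2 hlt
      -- Two penalties below `δ / 4` use up at most half of the gap, leaving `√n * (δ / 2)` for the
      -- fluctuations to exceed.
      have hv := fun j => tendstoInMeasure_iff_dist.1 (hpen.vanishing j) (δ / 4) (by linarith)
      have hw := ((hW k).add (hW k₀)).tendsto_measure (a := fun n : ℕ => √n * (δ / 2))
        (hsqrt.atTop_mul_const (by linarith))
      have hsum := (hw.add (hv k)).add (hv k₀)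
      simp only [add_zero] at hsum
      refine tendsto_of_tendsto_of_tendsto_of_le_of_le tendsto_const_nhds hsum
        (fun _ => zero_le) fun n => ?_
      refine le_trans ?_ ((measure_union_le _ _).trans (add_le_add_left (measure_union_le _ _) _))
      refine measure_mono_ae ?_
      filter_upwards [hdiff k] with ω hω hmem
      have h1 := hω n (hsel n ω hmem)
      by_contra hcon
      have hcon' : ¬ (√n * (δ / 2) ≤ W k n ω + W k₀ n ω) ∧ ¬ (δ / 4 ≤ dist (pen k n ω) 0) ∧
          ¬ (δ / 4 ≤ dist (pen k₀ n ω) 0) :=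
        ⟨fun h => hcon (Or.inl (Or.inl h)), fun h => hcon (Or.inl (Or.inr h)),
          fun h => hcon (Or.inr h)⟩
      simp only [not_le, Real.dist_eq, sub_zero, abs_lt] at hcon'
      obtain ⟨h2, h3, h4⟩ := hcon'
      have h5 : -(δ / 2) ≤ pen k n ω - pen k₀ n ω := by linarith
      have h6 := mul_le_mul_of_nonneg_left h5 (Real.sqrt_nonneg (n : ℝ))
      linarith
  have hsum := tendsto_finsetSum _ hk
  simp only [Finset.sum_const_zero] at hsum
  refine tendsto_of_tendsto_of_tendsto_of_le_of_le tendsto_const_nhds hsum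
    (fun _ => zero_le) fun n => ?_
  refine le_trans (measure_mono fun ω hω => ?_) (measure_biUnion_finset_le _ _)
  simp only [Set.mem_iUnion]
  exact ⟨_, Finset.mem_erase.2 ⟨hω, Finset.mem_univ _⟩, rfl⟩

end Selection

end PanIC

namespace PanIC

/-! ### Consistency for an arbitrary regular loss. -/

section Consistency

variable {Ω : Type*} [MeasurableSpace Ω] {P : Measure Ω}

theorem minValue_eq_of_isMinOn {Θ : Type*} {T : Set Θ} {f : Θ → ℝ} {θ : Θ} (hθ : θ ∈ T)
    (h : IsMinOn f T θ) : minValue T f = f θ := by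
  refine le_antisymm (csInf_le ⟨f θ, ?_⟩ ⟨θ, hθ, rfl⟩) (le_csInf ⟨_, θ, hθ, rfl⟩ ?_)
  · rintro _ ⟨θ', hθ', rfl⟩
    exact h hθ'
  · rintro _ ⟨θ', hθ', rfl⟩
    exact h hθ'

theorem tendstoInMeasure_of_tendsto_measure_ne {f : ℕ → Ω → ℝ} {g : Ω → ℝ}
    (h : Tendsto (fun n => P {ω | f n ω ≠ g ω}) atTop (𝓝 0)) :
    TendstoInMeasure P f atTop g := by
  intro ε hε
  refine tendsto_of_tendsto_of_tendsto_of_le_of_le tendsto_const_nhds h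
    (fun _ => zero_le) fun n => measure_mono fun ω hω => ?_
  intro heq
  simp only [Set.mem_ofPred_eq, heq, edist_self] at hω
  exact absurd hω (not_le.2 hε)

theorem IsRegularLoss.consistent [IsProbabilityMeasure P] {d m : ℕ} [NeZero m]
    {X : ℕ → Ω → EuclideanSpace ℝ (Fin d)} {Y : ℕ → Ω → ℝ} {ψ ψ' : ℝ → ℝ → ℝ}
    (h : IsRegularLoss P (X 0) (Y 0) ψ ψ')
    (hindep : iIndepFun (fun i ω => (X i ω, Y i ω)) P)
    (hident : ∀ i, IdentDistrib (fun ω => (X i ω, Y i ω)) (fun ω => (X 0 ω, Y 0 ω)) P P)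
    {U : Set ℝ} (hU : IsCompact U) (hU_ne : U.Nonempty)
    {B : Fin m → Set (EuclideanSpace ℝ (Fin d))} (hBc : ∀ k, IsCompact (B k))
    (hB : ∀ k, Convex ℝ (B k)) (hB_ne : ∀ k, (B k).Nonempty)
    {ℓ : EuclideanSpace ℝ (Fin d) × ℝ → ℝ × EuclideanSpace ℝ (Fin d) → ℝ} {a : ℝ → ℝ}
    (hℓ : ∀ z θ, ℓ z θ = ψ z.2 (linPred θ z.1) + a z.2) (ha : Integrable (fun ω => a (Y 0 ω)) P)
    {pen : Fin m → ℕ → Ω → ℝ} (hpen : IsPenalty P pen) :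
    (∀ k, ∀ θ ∈ U ×ˢ B k, Integrable (fun ω => ℓ (X 0 ω, Y 0 ω) θ) P) ∧
    (∀ k, ∃ θ ∈ U ×ˢ B k,
      IsMinOn (expectedRisk P ℓ (fun ω => (X 0 ω, Y 0 ω))) (U ×ˢ B k) θ) ∧
    (∀ n ω k, ∃ θ ∈ U ×ˢ B k,
      IsMinOn (empiricalRisk ℓ (fun i ω => (X i ω, Y i ω)) n ω) (U ×ˢ B k) θ) ∧
    TendstoInMeasure P
      (fun n ω => ((panicIndex ℓ (fun k => U ×ˢ B k)
        (fun i ω => (X i ω, Y i ω)) pen n ω : ℕ) : ℝ)) atTop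
      (fun _ => ((optimalIndex P ℓ (fun k => U ×ˢ B k) (fun ω => (X 0 ω, Y 0 ω)) : ℕ) : ℝ)) := by
  set Z : ℕ → Ω → EuclideanSpace ℝ (Fin d) × ℝ := fun i ω => (X i ω, Y i ω) with hZ
  have hTc : ∀ k, IsCompact (U ×ˢ B k) := fun k => hU.prod (hBc k)
  have hT_ne : ∀ k, (U ×ˢ B k).Nonempty := fun k => hU_ne.prod (hB_ne k)
  have hrisk : ∀ θ, expectedRisk P ℓ (fun ω => (X 0 ω, Y 0 ω)) θ =
      linRisk P (X 0) (Y 0) ψ θ + ∫ ω, a (Y 0 ω) ∂P := by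
    intro θ
    simp only [expectedRisk, linRisk, hℓ]
    exact integral_add (h.integrable θ) ha
  have hemp : ∀ n ω θ, empiricalRisk ℓ Z n ω θ =
      sampleMean Z n (fun z => ψ z.2 (linPred θ z.1)) ω + sampleMean Z n (fun z => a z.2) ω := by
    intro n ω θ
    rw [← sampleMean_add]
    simp only [empiricalRisk, sampleMean, hℓ]
  have hmin_r : ∀ k, ∃ θ ∈ U ×ˢ B k,
      IsMinOn (expectedRisk P ℓ (fun ω => (X 0 ω, Y 0 ω))) (U ×ˢ B k) θ := by
    intro k
    refine (hTc k).exists_isMinOn (hT_ne k) (Continuous.continuousOn ?_)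
    rw [funext hrisk]
    exact h.continuous_linRisk.add continuous_const
  have hmin_R : ∀ n ω k, ∃ θ ∈ U ×ˢ B k, IsMinOn (empiricalRisk ℓ Z n ω) (U ×ˢ B k) θ := by
    intro n ω k
    refine (hTc k).exists_isMinOn (hT_ne k) (Continuous.continuousOn ?_)
    have hψ := h.continuous
    simp only [funext (hemp n ω), sampleMean]
    fun_prop
  refine ⟨fun k θ _ => ?_, hmin_r, hmin_R, tendstoInMeasure_of_tendsto_measure_ne ?_⟩
  · simp only [hℓ]
    exact (h.integrable θ).add ha
  choose θ₀ hθ₀ hθ₀min using hmin_r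
  have hmin₀ : ∀ k, ∀ θ ∈ U ×ˢ B k,
      linRisk P (X 0) (Y 0) ψ (θ₀ k) ≤ linRisk P (X 0) (Y 0) ψ θ := by
    intro k θ hθ
    have : expectedRisk P ℓ (fun ω => (X 0 ω, Y 0 ω)) (θ₀ k) ≤ _ := hθ₀min k hθ
    rw [hrisk, hrisk] at this
    linarith
  choose W hW hWb using fun k => h.exists_lower_bound hindep hident hU (hBc k) (hB k) (hmin₀ k)
  have hV : ∀ k, BoundedInProb P (fun n ω => √n *
      |sampleMean Z n (fun z => ψ z.2 (linPred (θ₀ k) z.1)) ω -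
        linRisk P (X 0) (Y 0) ψ (θ₀ k)|) := fun k =>
    boundedInProb_sampleMean hindep hident
      (f := fun z : EuclideanSpace ℝ (Fin d) × ℝ => ψ z.2 (linPred (θ₀ k) z.1))
      (h.measurable.comp (measurable_snd.prodMk
        ((continuous_linPred (θ₀ k)).measurable.comp measurable_fst))) (h.memLp (θ₀ k))
  have hWmax : ∀ k, BoundedInProb P (fun n ω => max (W k n ω) (√n *
      |sampleMean Z n (fun z => ψ z.2 (linPred (θ₀ k) z.1)) ω -
        linRisk P (X 0) (Y 0) ψ (θ₀ k)|)) := fun k => (hW k).max (hV k)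
  have hmain := tendsto_measure_minArgmin_ne hpen
    (s := fun k n ω => minValue (U ×ˢ B k) (empiricalRisk ℓ Z n ω))
    (S := fun k => minValue (U ×ˢ B k) (expectedRisk P ℓ (fun ω => (X 0 ω, Y 0 ω))))
    -- The response-only fluctuation goes into the common centring, so `a` need only be integrable,
    -- not square-integrable.
    (c := fun n ω => sampleMean Z n (fun z => a z.2) ω - ∫ ω, a (Y 0 ω) ∂P) hWmax (by
      intro k
      filter_upwards [hWb k] with ω hω n
      obtain ⟨θ, hθ, hθmin⟩ := hmin_R n ω k
      have hn : 0 ≤ √(n : ℝ) := Real.sqrt_nonneg _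
      have hle : empiricalRisk ℓ Z n ω θ ≤ empiricalRisk ℓ Z n ω (θ₀ k) := hθmin (hθ₀ k)
      rw [minValue_eq_of_isMinOn hθ hθmin, minValue_eq_of_isMinOn (hθ₀ k) (hθ₀min k), hrisk, hemp]
      rw [hemp, hemp] at hle
      have hlow := hω n θ hθ
      rw [← abs_of_nonneg hn, ← abs_mul, abs_of_nonneg hn, abs_le]
      constructor
      · refine le_trans (neg_le_neg (le_max_left _ _)) (hlow.trans (le_of_eq ?_))
        ring
      · refine le_trans ?_ (le_max_right _ _)
        refine mul_le_mul_of_nonneg_left (le_trans ?_ (le_abs_self _)) hn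
        linarith)
  refine tendsto_of_tendsto_of_tendsto_of_le_of_le tendsto_const_nhds hmain
    (fun _ => zero_le) fun n => measure_mono fun ω hω heq => hω ?_
  simp only [panicIndex, optimalIndex]
  rw [heq]

end Consistency

/-! ### Compactness and convexity of the constraint sets. -/

namespace Constraint

variable {d : ℕ}

theorem sum_abs_convexOn :
    ConvexOn ℝ Set.univ (fun β : EuclideanSpace ℝ (Fin d) => ∑ j, |β j|) := by
  refine ⟨convex_univ, fun x _ y _ a b ha hb _ => ?_⟩
  simp only [smul_eq_mul, Finset.mul_sum, ← Finset.sum_add_distrib, PiLp.add_apply,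
    PiLp.smul_apply]
  refine Finset.sum_le_sum fun j _ => (abs_add_le _ _).trans ?_
  rw [abs_mul, abs_mul, abs_of_nonneg ha, abs_of_nonneg hb]

theorem convexOn_size (R : Constraint) :
    ConvexOn ℝ Set.univ (R.size : EuclideanSpace ℝ (Fin d) → ℝ) := by
  cases R with
  | lasso => exact sum_abs_convexOn
  | ridge => exact convexOn_univ_norm
  | elasticNet α hα =>
    exact (sum_abs_convexOn.smul hα.1.le).add
      ((convexOn_univ_norm.pow (fun _ _ => norm_nonneg _) 2).smul (sub_nonneg.2 hα.2.le))

theorem continuous_size (R : Constraint) :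
    Continuous (R.size : EuclideanSpace ℝ (Fin d) → ℝ) := by
  cases R <;> unfold size <;> fun_prop

theorem norm_le_sum_abs (β : EuclideanSpace ℝ (Fin d)) : ‖β‖ ≤ ∑ j, |β j| := by
  rw [EuclideanSpace.norm_eq]
  refine Real.sqrt_le_iff.2 ⟨Finset.sum_nonneg fun _ _ => abs_nonneg _, ?_⟩
  exact Finset.sum_sq_le_sq_sum_of_nonneg fun _ _ => abs_nonneg _

theorem exists_norm_le_mul_size (R : Constraint) :
    ∃ c : ℝ, ∀ β : EuclideanSpace ℝ (Fin d), ‖β‖ ≤ c * R.size β := by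
  cases R with
  | lasso => exact ⟨1, fun β => by simpa [size] using norm_le_sum_abs β⟩
  | ridge => exact ⟨1, fun β => by simp [size]⟩
  | elasticNet α hα =>
    refine ⟨α⁻¹, fun β => ?_⟩
    rw [inv_mul_eq_div, le_div_iff₀' hα.1]
    have h1 := mul_le_mul_of_nonneg_left (norm_le_sum_abs β) hα.1.le
    have h2 : 0 ≤ (1 - α) * ‖β‖ ^ 2 := mul_nonneg (sub_nonneg.2 hα.2.le) (by positivity)
    simp only [size]
    linarith

theorem convex_size_le (R : Constraint) (C : ℝ) :
    Convex ℝ {β : EuclideanSpace ℝ (Fin d) | R.size β ≤ C} := by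
  simpa using R.convexOn_size.convex_le C

theorem isCompact_size_le (R : Constraint) (C : ℝ) :
    IsCompact {β : EuclideanSpace ℝ (Fin d) | R.size β ≤ C} := by
  obtain ⟨c, hc⟩ := R.exists_norm_le_mul_size (d := d)
  refine Metric.isCompact_of_isClosed_isBounded
    (isClosed_le R.continuous_size continuous_const) ?_
  refine isBounded_iff_forall_norm_le.2 ⟨|c| * |C|, fun β hβ => ?_⟩
  have hs : 0 ≤ R.size β := by
    cases R with
    | lasso => exact Finset.sum_nonneg fun _ _ => abs_nonneg _
    | ridge => exact norm_nonneg _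
    | elasticNet α hα =>
      exact add_nonneg (mul_nonneg hα.1.le (Finset.sum_nonneg fun _ _ => abs_nonneg _))
        (mul_nonneg (sub_nonneg.2 hα.2.le) (by positivity))
  calc ‖β‖ ≤ c * R.size β := hc β
    _ ≤ |c| * R.size β := mul_le_mul_of_nonneg_right (le_abs_self c) hs
    _ ≤ |c| * |C| := mul_le_mul_of_nonneg_left (le_trans hβ (le_abs_self C)) (abs_nonneg c)

theorem nonempty_size_le (R : Constraint) {C : ℝ} (hC : 0 ≤ C) :
    {β : EuclideanSpace ℝ (Fin d) | R.size β ≤ C}.Nonempty := by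
  refine ⟨0, ?_⟩
  cases R <;> simpa [size] using hC

end Constraint

end PanIC

namespace PanIC

/-! ### Integrability of products, linear predictors and their exponentials. -/

section Moments

variable {Ω : Type*} [MeasurableSpace Ω] {P : Measure Ω} {d : ℕ}
  {X : Ω → EuclideanSpace ℝ (Fin d)} {Y : Ω → ℝ}

theorem memLp_two_mul {f g : Ω → ℝ} (hf : MemLp f 4 P) (hg : MemLp g 4 P) :
    MemLp (fun ω => f ω * g ω) 2 P := by
  have : ENNReal.HolderTriple 4 4 2 := ⟨by
    rw [← two_mul, show (4 : ENNReal) = 2 * 2 by norm_num,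
      ENNReal.mul_inv (by simp) (by simp), ← mul_assoc, ENNReal.mul_inv_cancel (by simp) (by simp),
      one_mul]⟩
  exact hg.mul hf

theorem memLp_four_mul {f g : Ω → ℝ} (hf : MemLp f 8 P) (hg : MemLp g 8 P) :
    MemLp (fun ω => f ω * g ω) 4 P := by
  have : ENNReal.HolderTriple 8 8 4 := ⟨by
    rw [← two_mul, show (8 : ENNReal) = 2 * 4 by norm_num,
      ENNReal.mul_inv (by simp) (by simp), ← mul_assoc, ENNReal.mul_inv_cancel (by simp) (by simp),
      one_mul]⟩
  exact hg.mul hf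

theorem memLp_coord {p : ENNReal} (hX : MemLp X p P) (j : Fin d) :
    MemLp (fun ω => X ω j) p P :=
  hX.of_le ((by fun_prop : Continuous fun x : EuclideanSpace ℝ (Fin d) =>
    x j).comp_aestronglyMeasurable hX.aestronglyMeasurable)
    (Eventually.of_forall fun ω => PiLp.norm_apply_le (X ω) j)

theorem memLp_linPred [IsFiniteMeasure P] {p : ENNReal} (hX : ∀ j, MemLp (fun ω => X ω j) p P)
    (θ : ℝ × EuclideanSpace ℝ (Fin d)) : MemLp (fun ω => linPred θ (X ω)) p P := by
  simp only [linPred_eq_sum]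
  exact (memLp_const θ.1).add (memLp_finsetSum _ fun j _ => (hX j).const_mul _)

/-- Gaussian and sub-Gaussian vectors have exponential moments of all orders. -/
theorem integrable_exp_linPred
    (hX : HasGaussianLaw X P ∨ IsSubGaussian P X) (θ : ℝ × EuclideanSpace ℝ (Fin d)) (t : ℝ) :
    Integrable (fun ω => Real.exp (t * linPred θ (X ω))) P := by
  have key : ∃ c : ℝ, Integrable (fun ω => Real.exp (t * (inner ℝ θ.2 (X ω) - c))) P := by
    rcases hX with hX | ⟨c, hc⟩
    · refine ⟨0, ?_⟩
      have h1 : HasGaussianLaw (fun ω => inner ℝ θ.2 (X ω)) P := hX.map_fun (innerSL ℝ θ.2)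
      have h2 := integrable_exp_mul_gaussianReal (μ := P[fun ω => inner ℝ θ.2 (X ω)])
        (v := Var[fun ω => inner ℝ θ.2 (X ω); P].toNNReal) t
      rw [← h1.map_eq_gaussianReal] at h2
      simpa [Function.comp_def] using h2.comp_aemeasurable h1.aemeasurable
    · refine ⟨inner ℝ θ.2 (∫ ω', X ω' ∂P), ?_⟩
      simpa only [inner_sub_right] using (hc θ.2).integrable_exp_mul t
  obtain ⟨c, hc⟩ := key
  refine (hc.const_mul (Real.exp (t * (θ.1 + c)))).congr (Eventually.of_forall fun ω => ?_)
  simp only [linPred, ← Real.exp_add]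
  ring_nf

theorem memLp_linPred_of_exp (hX : ∀ (θ : ℝ × EuclideanSpace ℝ (Fin d)) (t : ℝ),
    Integrable (fun ω => Real.exp (t * linPred θ (X ω))) P)
    (θ : ℝ × EuclideanSpace ℝ (Fin d)) (p : NNReal) :
    MemLp (fun ω => linPred θ (X ω)) p P := by
  refine memLp_of_mem_interior_integrableExpSet ?_ p
  have : integrableExpSet (fun ω => linPred θ (X ω)) P = Set.univ :=
    Set.eq_univ_of_forall fun t => hX θ t
  rw [this, interior_univ]
  exact Set.mem_univ 0

theorem memLp_coord_of_exp (hX : ∀ (θ : ℝ × EuclideanSpace ℝ (Fin d)) (t : ℝ),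
    Integrable (fun ω => Real.exp (t * linPred θ (X ω))) P) (j : Fin d) (p : NNReal) :
    MemLp (fun ω => X ω j) p P := by
  have := memLp_linPred_of_exp hX (0, EuclideanSpace.single j 1) p
  simpa [linPred, EuclideanSpace.inner_single_left] using this

/-- The `p`-th power of the exponential is the exponential with parameter `p * t`, again integrable.
-/
theorem memLp_exp_linPred (hX : ∀ (θ : ℝ × EuclideanSpace ℝ (Fin d)) (t : ℝ),
    Integrable (fun ω => Real.exp (t * linPred θ (X ω))) P)
    (θ : ℝ × EuclideanSpace ℝ (Fin d)) (t : ℝ) {p : ℕ} (hp : p ≠ 0) :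
    MemLp (fun ω => Real.exp (t * linPred θ (X ω))) p P := by
  rw [← integrable_norm_rpow_iff (hX θ t).aestronglyMeasurable (by simpa using hp) (by simp)]
  refine (hX θ (p * t)).congr (Eventually.of_forall fun ω => ?_)
  simp only [Real.norm_eq_abs, Real.abs_exp, ENNReal.toReal_natCast, Real.rpow_natCast,
    ← Real.exp_nat_mul, mul_assoc]

end Moments

/-! ### The four models as regular losses. -/

namespace GLM

/-- The part of the loss that depends on the linear predictor. -/
noncomputable def linLoss : GLM → ℝ → ℝ → ℝ
  | linear, y, η => (y - η) ^ 2
  | logistic, y, η => Real.log (1 + Real.exp η) - y * η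
  | poisson, y, η => Real.exp η - y * η
  | gamma ν _, y, η => ν * η + ν * (y * Real.exp (-η))

/-- The derivative of `linLoss` in the linear predictor. -/
noncomputable def linLossDeriv : GLM → ℝ → ℝ → ℝ
  | linear, y, η => -2 * (y - η)
  | logistic, y, η => (1 + Real.exp (-η))⁻¹ - y
  | poisson, y, η => Real.exp η - y
  | gamma ν _, y, η => ν - ν * (y * Real.exp (-η))

/-- The part of the loss that depends on the response only. -/
noncomputable def responseLoss : GLM → ℝ → ℝ
  | linear, _ => 0
  | logistic, _ => 0
  | poisson, y => Real.log (Nat.factorial ⌊y⌋₊)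
  | gamma ν _, y => -((ν - 1) * Real.log y)

theorem loss_eq {d : ℕ} (G : GLM) (z : EuclideanSpace ℝ (Fin d) × ℝ)
    (θ : ℝ × EuclideanSpace ℝ (Fin d)) :
    G.loss z θ = G.linLoss z.2 (linPred θ z.1) + G.responseLoss z.2 := by
  unfold loss
  change G.lossOfMean (G.mean (linPred θ z.1)) z.2 = _
  generalize linPred θ z.1 = η
  generalize z.2 = y
  cases G with
  | linear => simp [lossOfMean, mean, linLoss, responseLoss]
  | logistic =>
    have h0 : 1 + Real.exp (-η) ≠ 0 := by positivity
    have h1 : 1 + Real.exp η = Real.exp η * (1 + Real.exp (-η)) := by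
      rw [mul_add, ← Real.exp_add]
      simp [add_comm]
    have h2 : 1 - (1 + Real.exp (-η))⁻¹ = Real.exp (-η) * (1 + Real.exp (-η))⁻¹ := by
      field_simp
      ring
    simp only [lossOfMean, mean, linLoss, responseLoss]
    rw [h2, h1, Real.log_mul (Real.exp_ne_zero _) h0,
      Real.log_mul (Real.exp_ne_zero _) (inv_ne_zero h0), Real.log_inv, Real.log_exp, Real.log_exp]
    ring
  | poisson =>
    simp only [lossOfMean, mean, linLoss, responseLoss, Real.log_exp]
    ring
  | gamma ν hν =>
    simp only [lossOfMean, mean, linLoss, responseLoss, Real.log_exp, Real.exp_neg, div_eq_mul_inv]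
    ring

theorem measurableSet_responses (G : GLM) : MeasurableSet G.responses := by
  cases G with
  | linear => exact MeasurableSet.univ
  | logistic => exact (Set.toFinite ({0, 1} : Set ℝ)).measurableSet
  | poisson => exact (Set.countable_range _).measurableSet
  | gamma ν hν => exact measurableSet_Ioi

/-- After exponentiation this is convexity of `exp` between `0` and `t - s` with weights `1 - p` and
`p`, since `(1 + e^s) * (1 - p + p * e^(t - s)) = 1 + e^t`. -/
theorem logistic_tangent (s t : ℝ) :
    Real.log (1 + Real.exp s) + (1 + Real.exp (-s))⁻¹ * (t - s) ≤ Real.log (1 + Real.exp t) := by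
  set p := (1 + Real.exp (-s))⁻¹ with hp
  have hp0 : 0 ≤ p := by positivity
  have hp1 : p ≤ 1 := inv_le_one_of_one_le₀ (by linarith [Real.exp_pos (-s)])
  have h := convexOn_exp.2 (Set.mem_univ 0) (Set.mem_univ (t - s)) (sub_nonneg.2 hp1) hp0
    (sub_add_cancel 1 p)
  simp only [smul_eq_mul, mul_zero, zero_add, Real.exp_zero, mul_one] at h
  rw [Real.le_log_iff_exp_le (by positivity), Real.exp_add, Real.exp_log (by positivity)]
  refine (mul_le_mul_of_nonneg_left h (by positivity)).trans (le_of_eq ?_)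
  rw [hp, Real.exp_neg, Real.exp_sub]
  have := Real.exp_pos s
  field_simp
  ring

theorem linLoss_tangent (G : GLM) {y : ℝ} (hy : y ∈ G.responses) (s t : ℝ) :
    G.linLoss y s + G.linLossDeriv y s * (t - s) ≤ G.linLoss y t := by
  cases G with
  | linear =>
    simp only [linLoss, linLossDeriv]
    nlinarith [sq_nonneg (t - s)]
  | logistic =>
    simp only [linLoss, linLossDeriv]
    linarith [logistic_tangent s t]
  | poisson =>
    have h := mul_le_mul_of_nonneg_left (Real.add_one_le_exp (t - s)) (Real.exp_pos s).le
    rw [← Real.exp_add, add_sub_cancel] at h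
    simp only [linLoss, linLossDeriv]
    linarith
  | gamma ν hν =>
    have h := mul_le_mul_of_nonneg_left (Real.add_one_le_exp (-(t - s))) (Real.exp_pos (-s)).le
    rw [← Real.exp_add, show -s + -(t - s) = -t by ring] at h
    have h' := mul_le_mul_of_nonneg_left h (mul_nonneg hν.le (le_of_lt hy))
    simp only [linLoss, linLossDeriv]
    linarith

variable {Ω : Type*} [MeasurableSpace Ω] {P : Measure Ω} [IsProbabilityMeasure P] {d : ℕ}
  {X : Ω → EuclideanSpace ℝ (Fin d)} {Y : Ω → ℝ}

theorem integrable_responseLoss (G : GLM) (hYm : AEMeasurable Y P)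
    (hY : ∀ᵐ ω ∂P, Y ω ∈ G.responses) (hcond : G.Condition P X Y) :
    Integrable (fun ω => G.responseLoss (Y ω)) P := by
  cases G with
  | linear => exact integrable_zero _ _ _
  | logistic => exact integrable_zero _ _ _
  | poisson =>
    have h2 : MemLp Y 2 P := hcond.2.mono_exponent (by norm_num)
    have hm : Measurable fun y : ℝ => Real.log (Nat.factorial ⌊y⌋₊) :=
      (measurable_from_nat (f := fun n : ℕ => Real.log (Nat.factorial n))).comp Nat.measurable_floor
    refine h2.integrable_sq.mono (hm.comp_aemeasurable hYm).aestronglyMeasurable ?_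
    filter_upwards [hY] with ω hω
    obtain ⟨n, hn⟩ := hω
    simp only [responseLoss, ← hn, Nat.floor_natCast]
    have h1 : (1 : ℝ) ≤ Nat.factorial n := by exact_mod_cast Nat.factorial_pos n
    rw [Real.norm_of_nonneg (Real.log_nonneg h1), Real.norm_of_nonneg (by positivity)]
    -- The crude bound `log n! ≤ n ^ 2` suffices because `Y` is square-integrable.
    calc Real.log (Nat.factorial n) ≤ Real.log ((n : ℝ) ^ n) :=
          Real.log_le_log (by positivity) (by exact_mod_cast Nat.factorial_le_pow n)
      _ = n * Real.log n := Real.log_pow n n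
      _ ≤ n * n := mul_le_mul_of_nonneg_left (Real.log_le_self n.cast_nonneg) n.cast_nonneg
      _ = (n : ℝ) ^ 2 := (sq _).symm
  | gamma ν hν =>
    by_cases h : ν = 1
    · simp [responseLoss, h]
    · exact ((hcond.2.2 h).const_mul _).neg

theorem isRegularLoss (G : GLM) (hXm : AEMeasurable X P) (hYm : AEMeasurable Y P)
    (hY : ∀ᵐ ω ∂P, Y ω ∈ G.responses) (hcond : G.Condition P X Y) :
    IsRegularLoss P X Y G.linLoss G.linLossDeriv := by
  suffices hmom : ∀ θ, MemLp (fun ω => G.linLoss (Y ω) (linPred θ (X ω))) 2 P ∧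
      MemLp (fun ω => G.linLossDeriv (Y ω) (linPred θ (X ω))) 2 P ∧
      ∀ j, MemLp (fun ω => G.linLossDeriv (Y ω) (linPred θ (X ω)) * X ω j) 2 P from
    { measurable := by cases G <;> unfold linLoss <;> fun_prop
      measurable_deriv := by cases G <;> unfold linLossDeriv <;> fun_prop
      continuous := fun y => by
        cases G with
        | logistic =>
          unfold linLoss
          exact (Continuous.log (by fun_prop) fun η => by positivity).sub (by fun_prop)
        | _ => unfold linLoss; fun_prop
      continuous_deriv := fun y => by
        cases G with
        | logistic =>
          unfold linLossDeriv
          exact (Continuous.inv₀ (by fun_prop) fun η => by positivity).sub continuous_const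
        | _ => unfold linLossDeriv; fun_prop
      tangent_on := ⟨G.responses, G.measurableSet_responses, hY,
        fun y hy s t => G.linLoss_tangent hy s t⟩
      memLp := fun θ => (hmom θ).1
      memLp_deriv := fun θ => (hmom θ).2.1
      memLp_deriv_mul := fun θ => (hmom θ).2.2 }
  intro θ
  cases G with
  | linear =>
    obtain ⟨hX, hY4⟩ := hcond
    have hX4 := memLp_coord hX
    have hres : MemLp (fun ω => Y ω - linPred θ (X ω)) 4 P := hY4.sub (memLp_linPred hX4 θ)
    simp only [linLoss, linLossDeriv, sq]
    exact ⟨memLp_two_mul hres hres, (hres.const_mul _).mono_exponent (by norm_num),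
      fun j => memLp_two_mul (hres.const_mul _) (hX4 j)⟩
  | logistic =>
    have hX2 := memLp_coord (show MemLp X 2 P from hcond)
    have hη := memLp_linPred hX2 θ
    have hηm := hη.aestronglyMeasurable.aemeasurable
    have hYb : ∀ᵐ ω ∂P, |Y ω| ≤ 1 := by
      filter_upwards [hY] with ω hω
      rcases hω with h | h
      · simp [h]
      · rw [Set.mem_singleton_iff.1 h]; simp
    have hYt : MemLp Y ⊤ P := memLp_top_of_bound hYm.aestronglyMeasurable 1 hYb
    have hσ : MemLp (fun ω => (1 + Real.exp (-linPred θ (X ω)))⁻¹) ⊤ P := by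
      refine memLp_top_of_bound (by fun_prop) 1 (Eventually.of_forall fun ω => ?_)
      rw [Real.norm_of_nonneg (by positivity)]
      exact inv_le_one_of_one_le₀ (by linarith [Real.exp_pos (-linPred θ (X ω))])
    -- The logistic derivative is bounded, which is why a second moment of `X` is enough.
    have hD : MemLp (fun ω => (1 + Real.exp (-linPred θ (X ω)))⁻¹ - Y ω) ⊤ P := hσ.sub hYt
    simp only [linLoss, linLossDeriv]
    refine ⟨MemLp.sub ?_ (hη.mul hYt), hD.mono_exponent le_top, fun j => (hX2 j).mul hD⟩
    refine ((memLp_const (Real.log 2)).add hη.norm).of_le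
      (hηm.exp.const_add 1).log.aestronglyMeasurable
      (Eventually.of_forall fun ω => ?_)
    set η := linPred θ (X ω)
    have h1 : 0 ≤ Real.log (1 + Real.exp η) :=
      Real.log_nonneg (by linarith [Real.exp_pos η])
    have h2 : Real.log (1 + Real.exp η) ≤ Real.log 2 + |η| := by
      rw [← Real.log_exp |η|, ← Real.log_mul two_ne_zero (Real.exp_ne_zero _)]
      refine Real.log_le_log (by positivity) ?_
      linarith [Real.exp_le_exp.2 (le_abs_self η), Real.one_le_exp (abs_nonneg η)]
    rw [Real.norm_of_nonneg h1]
    exact h2.trans (le_abs_self _)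
  | poisson =>
    obtain ⟨hX, hY4⟩ := hcond
    have hexp := integrable_exp_linPred hX
    have hη : MemLp (fun ω => linPred θ (X ω)) 4 P := memLp_linPred_of_exp hexp θ 4
    have hX4 : ∀ j, MemLp (fun ω => X ω j) 4 P := fun j => memLp_coord_of_exp hexp j 4
    have he : MemLp (fun ω => Real.exp (linPred θ (X ω))) 4 P := by
      simpa using memLp_exp_linPred hexp θ 1 (p := 4) (by norm_num)
    simp only [linLoss, linLossDeriv]
    exact ⟨(he.mono_exponent (by norm_num)).sub (memLp_two_mul hY4 hη),
      (he.sub hY4).mono_exponent (by norm_num), fun j => memLp_two_mul (he.sub hY4) (hX4 j)⟩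
  | gamma ν hν =>
    obtain ⟨hX, hY4, -⟩ := hcond
    have hexp := integrable_exp_linPred hX
    have hη : MemLp (fun ω => linPred θ (X ω)) 2 P := memLp_linPred_of_exp hexp θ 2
    have hX8 : ∀ j, MemLp (fun ω => X ω j) 8 P := fun j => memLp_coord_of_exp hexp j 8
    have he : MemLp (fun ω => Real.exp (-linPred θ (X ω))) 8 P := by
      simpa using memLp_exp_linPred hexp θ (-1) (p := 8) (by norm_num)
    have hYe := memLp_two_mul hY4 (he.mono_exponent (q := 8) (p := 4) (by norm_num))
    simp only [linLoss, linLossDeriv]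
    refine ⟨(hη.const_mul _).add (hYe.const_mul _), (memLp_const _).sub (hYe.const_mul _),
      fun j => ?_⟩
    -- Hölder with exponents `4, 8, 8`: `Y` has only four moments, so the exponential and the
    -- coordinate share the other `1 / 4`.
    have hYeX := memLp_two_mul hY4 (memLp_four_mul he (hX8 j))
    refine ((((hX8 j).mono_exponent (p := 2) (by norm_num)).const_mul ν).sub
      (hYeX.const_mul ν)).ae_eq (Eventually.of_forall fun ω => ?_)
    simp only [Pi.sub_apply]
    ring

end GLM

end PanIC

theorem mainTheorem2 {Ω : Type*} [MeasurableSpace Ω] (P : Measure Ω) [IsProbabilityMeasure P]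
    {d m : ℕ} [NeZero m]
    -- the regression problem, the type of constraint, and the finitely many models
    (G : PanIC.GLM) (R : PanIC.Constraint)
    (U : Set ℝ) (hU : IsCompact U) (hU_ne : U.Nonempty)
    (C : Fin m → ℝ) (hC : ∀ k, 0 ≤ C k)
    -- the i.i.d. sample
    (X : ℕ → Ω → EuclideanSpace ℝ (Fin d)) (Y : ℕ → Ω → ℝ)
    (hindep : iIndepFun (fun i ω => (X i ω, Y i ω)) P)
    (hident : ∀ i, IdentDistrib (fun ω => (X i ω, Y i ω)) (fun ω => (X 0 ω, Y 0 ω)) P P)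
    (hY : ∀ᵐ ω ∂P, Y 0 ω ∈ G.responses)
    (hcond : G.Condition P (X 0) (Y 0))
    -- the penalties
    (pen : Fin m → ℕ → Ω → ℝ) (hpen : PanIC.IsPenalty P pen) :
    -- the expected risk is finite and all the minima exist
    (∀ k, ∀ θ ∈ R.paramSpace d U (C k), Integrable (fun ω => G.loss (X 0 ω, Y 0 ω) θ) P) ∧
    (∀ k, ∃ θ ∈ R.paramSpace d U (C k),
      IsMinOn (PanIC.expectedRisk P G.loss (fun ω => (X 0 ω, Y 0 ω)))
        (R.paramSpace d U (C k)) θ) ∧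
    (∀ n ω k, ∃ θ ∈ R.paramSpace d U (C k),
      IsMinOn (PanIC.empiricalRisk G.loss (fun i ω => (X i ω, Y i ω)) n ω)
        (R.paramSpace d U (C k)) θ) ∧
    -- the PanIC estimator converges in probability to the optimal index
    TendstoInMeasure P
      (fun n ω => ((PanIC.panicIndex G.loss (fun k => R.paramSpace d U (C k))
        (fun i ω => (X i ω, Y i ω)) pen n ω : ℕ) : ℝ))
      atTop
      (fun _ => ((PanIC.optimalIndex P G.loss (fun k => R.paramSpace d U (C k))
        (fun ω => (X 0 ω, Y 0 ω)) : ℕ) : ℝ)) := by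
  have hm := (hident 0).aemeasurable_fst
  have hXm : AEMeasurable (X 0) P := hm.fst
  have hYm : AEMeasurable (Y 0) P := hm.snd
  exact (G.isRegularLoss hXm hYm hY hcond).consistent hindep hident hU hU_ne
    (fun k => R.isCompact_size_le (C k)) (fun k => R.convex_size_le (C k))
    (fun k => R.nonempty_size_le (hC k)) G.loss_eq (G.integrable_responseLoss hYm hY hcond) hpen
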